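/- Let $q\in(0,1)$ and let $a,b$ be real numbers with $a\neq 0$, $b<0$ and $|b|>|a|$. Put $$\kappa:=-\frac{\log|b/a|}{\log(1/q)}<0.$$ Let $f\in C([0,\infty);\mathbb R)$, $\zeta\in\mathbb R$, let $x$ be the unique continuous solution of the forced pantograph equation $$x'(t)=a\,x(qt)+b\,x(t)+f(t),\quad t\ge 0;\qquad x(0)=\zeta,$$ and let $y$ be the solution of $$y'(t)=-y(t)+f(t),\quad t\ge 0;\qquad y(0)=0.$$ Let $\eta\in\mathbb R$ and let $\gamma\in \mathrm{RV}_\infty(\eta)$, that is, $\gamma:[0,\infty)\to(0,\infty)$ is measurable and $\lim_{t\to\infty}\gamma(\lambda t)/\gamma(t)=\lambda^\eta$ for every $\lambda>0$. (i) Suppose that $y(t)=O(\gamma(t))$ as $t\to\infty$. (A) If $\eta<\kappa$, then $x(t)=O(t^\kappa)$ as $t\to\infty$. (B) If $\eta=\kappa$ and $t\mapsto\gamma(t)/t^{\kappa+1}$ is in $L^1(1,\infty)$, then $x(t)=O(t^\kappa)$ as $t\to\infty$. Moreover, if $\limsup_{t\to\infty}|y(t)|/\gamma(t)\in(0,\infty)$,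 then $\limsup_{t\to\infty}|x(t)|/\gamma(t)>0$. (C) If $\eta=\kappa$ and $t\mapsto\gamma(t)/t^{\kappa+1}$ is not in $L^1(1,\infty)$, then $$x(t)=O\left(t^\kappa\int_1^t\frac{\gamma(s)}{s^{\kappa+1}}\,ds\right),\quad t\to\infty,$$ where the integral of the positive measurable integrand is taken with values in $[0,\infty]$. Moreover, if $\limsup_{t\to\infty}|y(t)|/\gamma(t)>0$, then $\limsup_{t\to\infty}|x(t)|/\gamma(t)>0$. (ii) (Without assuming $y=O(\gamma)$, and for any $\eta\in\mathbb R$.) If $x(t)=O(\gamma(t))$ as $t\to\infty$, then $y(t)=O(\gamma(t))$ as $t\to\infty$. Likewise, if $x(t)=o(\gamma(t))$ as $t\to\infty$, then $y(t)=o(\gamma(t))$ as $t\to\infty$. -/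

import Mathlib

open MeasureTheory Filter Topology Asymptotics Set
open scoped ENNReal NNReal

namespace Pantograph

/-- The exponent `κ = -log |b/a| / log (1/q)`. -/
noncomputable def kappa (a b q : ℝ) : ℝ := -Real.log |b / a| / Real.log (1 / q)

/-- `x` solves `x'(t) = a x(q t) + b x(t) + f(t)` for `t ≥ 0` (one-sided derivative at `t = 0`),
with `x(0) = ζ`. Only the values of `x` and `f` on `[0, ∞)` matter when `0 < q < 1`. -/
structure IsForcedSolution (a b q : ℝ) (f : ℝ → ℝ) (ζ : ℝ) (x : ℝ → ℝ) : Prop where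
  init : x 0 = ζ
  deriv : ∀ t : ℝ, 0 ≤ t → HasDerivWithinAt x (a * x (q * t) + b * x t + f t) (Ici 0) t

/-- `y` solves `y'(t) = -y(t) + f(t)` for `t ≥ 0`, with `y(0) = 0`. -/
structure IsAuxiliarySolution (f : ℝ → ℝ) (y : ℝ → ℝ) : Prop where
  init : y 0 = 0
  deriv : ∀ t : ℝ, 0 ≤ t → HasDerivWithinAt y (-y t + f t) (Ici 0) t

/-- `γ : [0, ∞) → (0, ∞)` is (Lebesgue) measurable and regularly varying at infinity with
index `η`. -/
structure IsRegularlyVarying (γ : ℝ → ℝ) (η : ℝ) : Prop where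
  measurable : AEMeasurable γ (volume.restrict (Ici 0))
  pos : ∀ t : ℝ, 0 ≤ t → 0 < γ t
  tendsto : ∀ l : ℝ, 0 < l → Tendsto (fun t => γ (l * t) / γ t) atTop (𝓝 (l ^ η))

/-- `limsup_{t → ∞} |u(t)| / γ(t)`, as an element of `[0, ∞]`. -/
noncomputable def limsupRatio (u γ : ℝ → ℝ) : ℝ≥0∞ :=
  limsup (fun t => ENNReal.ofReal (|u t| / γ t)) atTop

/-- `t ^ κ * ∫_1^t γ(s) / s^(κ+1) ds`, as an element of `[0, ∞]`. The integral of the positive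
measurable function `s ↦ γ(s) / s^(κ+1)` is taken with values in `[0, ∞]`, since a measurable `γ`
need not be locally integrable. -/
noncomputable def criticalBound (κ : ℝ) (γ : ℝ → ℝ) (t : ℝ) : ℝ≥0∞ :=
  ENNReal.ofReal (t ^ κ) * ∫⁻ s in Ioc 1 t, ENNReal.ofReal (γ s / s ^ (κ + 1))

end Pantograph

/-! Subtracting the two equations eliminates `f`, and this is used in both directions. For part
(ii), `w = y - x` solves `w' = -w - g` with `g` a combination of `x` and `x (q ·)`. The exponential
decay over a window `[q t, t]` beats the bounded change of `γ` there, so `w` inherits the `O(γ)` or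
`o(γ)` rate of `g` (`exists_ratio_recurrence`). The limsup claims are the contrapositive of the
`o(γ)` case. For part (i), `z = x - y` solves `z' = a z(q ·) + b z + g` with `g = O(γ)`. Since `|a|
q ^ κ = -b`, the power `t ^ κ` balances the delayed and the instantaneous term. Regular variation
bounds `γ t` by a multiple of `t ^ κ (I t - I (q t))`, where `I` is the primitive of `γ s / s ^ (κ +
1)`. Hence `t ^ κ (1 - c / t) (K + m I t)` is a strict barrier for `|z|`
(`exists_bound_of_increments`). (B) and (C) read off the size of `I`; (A) replaces `γ` by a power
between `η` and `κ`. Measurability of `γ` enters through a weak uniform convergence theorem,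
`exists_uniform_bound`. -/

namespace Pantograph

/-! ### Regularly varying functions -/

namespace IsRegularlyVarying

variable {γ : ℝ → ℝ} {η : ℝ}

lemma aemeasurable_comp_mul (hγ : IsRegularlyVarying γ η) (P : ℝ) {t : ℝ} (ht : 0 < t) :
    AEMeasurable (fun l => γ (l * t)) (volume.restrict (Icc 1 P)) := by
  refine hγ.measurable.comp_quasiMeasurePreserving (f := fun l : ℝ => l * t) ⟨by fun_prop, ?_⟩
  refine Measure.AbsolutelyContinuous.mk fun s hs hs0 => ?_
  have hm : Measurable fun l : ℝ => l * t := by fun_prop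
  rw [Measure.map_apply hm hs, Measure.restrict_apply (hm hs)]
  rw [Measure.restrict_apply hs] at hs0
  refine measure_mono_null (t := (· * t) ⁻¹' (s ∩ Ici 0)) ?_ ?_
  · rintro l ⟨hl, hl1, -⟩
    exact ⟨hl, mul_nonneg (by linarith) ht.le⟩
  · rw [Real.volume_preimage_mul_right ht.ne', hs0, mul_zero]

/-- The set of `l ∈ [1, P]` for which `γ (l t) / γ t` is far from `l ^ η`. -/
def badSet (γ : ℝ → ℝ) (η P t : ℝ) : Set ℝ :=
  {l | 1 / 2 ≤ |γ (l * t) / γ t / l ^ η - 1|} ∩ Icc 1 P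

/-- Pointwise convergence on a set of finite measure gives convergence in measure. That theorem
concerns sequences, hence the passage to `u`; the maximum with `1` keeps every dilation factor
positive. -/
lemma tendsto_volume_badSet (hγ : IsRegularlyVarying γ η) (P : ℝ) :
    Tendsto (fun t => volume (badSet γ η P t)) atTop (𝓝 0) := by
  refine tendsto_of_seq_tendsto fun u hu => ?_
  have hv : Tendsto (fun n => max (u n) 1) atTop atTop :=
    tendsto_atTop_mono (fun n => le_max_left _ _) hu
  have hpos : ∀ n, 0 < max (u n) 1 := fun n => lt_of_lt_of_le one_pos (le_max_right _ _)
  have key : TendstoInMeasure (volume.restrict (Icc 1 P))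
      (fun n l => γ (l * max (u n) 1) / γ (max (u n) 1) / l ^ η) atTop (fun _ => 1) := by
    refine tendstoInMeasure_of_tendsto_ae (fun n => ?_) ?_
    · exact (((hγ.aemeasurable_comp_mul P (hpos n)).div_const _).div
        (by fun_prop : Measurable fun l : ℝ => l ^ η).aemeasurable).aestronglyMeasurable
    · refine (ae_restrict_iff' measurableSet_Icc).2 (Eventually.of_forall fun l hl => ?_)
      have hl0 : 0 < l := by linarith [hl.1]
      have := ((hγ.tendsto l hl0).comp hv).div_const (l ^ η)
      rwa [div_self (Real.rpow_pos_of_pos hl0 η).ne'] at this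
  have h2 := key (ENNReal.ofReal (1 / 2)) (by norm_num)
  refine h2.congr' ?_
  filter_upwards [hu.eventually_ge_atTop 1] with n hn
  rw [Measure.restrict_apply' measurableSet_Icc, max_eq_left hn]
  change _ = volume (_ ∩ _)
  congr 2
  ext l
  simp only [mem_ofPred_eq, edist_dist, Real.dist_eq]
  rw [ENNReal.ofReal_le_ofReal_iff (abs_nonneg _)]

lemma bounds_of_notMem_badSet (hγ : IsRegularlyVarying γ η) {P t l : ℝ} (ht : 0 < t)
    (hl : l ∈ Icc 1 P) (h : l ∉ badSet γ η P t) :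
    γ (l * t) ≤ 3 / 2 * l ^ η * γ t ∧ 1 / 2 * l ^ η * γ t ≤ γ (l * t) := by
  have h1 : ¬ 1 / 2 ≤ |γ (l * t) / γ t / l ^ η - 1| := fun h' => h ⟨h', hl⟩
  rw [not_le, abs_lt] at h1
  have hl0 : 0 < l ^ η := Real.rpow_pos_of_pos (by linarith [hl.1]) η
  have hg := hγ.pos t ht.le
  have e : γ (l * t) = γ (l * t) / γ t / l ^ η * (l ^ η * γ t) := by field_simp
  have hp : 0 < l ^ η * γ t := mul_pos hl0 hg
  constructor <;> rw [e] <;> nlinarith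

/-- The uniform convergence theorem, in the weak form of two-sided bounds. -/
theorem exists_uniform_bound (hγ : IsRegularlyVarying γ η) {p : ℝ} (hp : 1 < p) :
    ∃ C > 0, ∃ T > 0, ∀ t ≥ T, ∀ s ≥ t, s ≤ p * t → γ s ≤ C * γ t ∧ γ t ≤ C * γ s := by
  have hδ : 0 < ENNReal.ofReal (1 / (2 * (p + 1))) := by
    rw [ENNReal.ofReal_pos]; positivity
  obtain ⟨T, hT⟩ := eventually_atTop.1
    (((hγ.tendsto_volume_badSet (p + 1)).eventually_lt_const hδ).and (eventually_ge_atTop 1))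
  -- The `3` is the quotient of the bounds `3 / 2` and `1 / 2`; `p ^ |η|` bounds both `m ^ η` and `m
  -- ^ (-η)` for `1 ≤ m ≤ p`.
  refine ⟨3 * p ^ |η|, by positivity, max T 1, by positivity, fun t ht s hts hsp => ?_⟩
  have htT := le_trans (le_max_left T 1) ht
  have ht1 := le_trans (le_max_right T 1) ht
  have ht0 : 0 < t := by linarith
  obtain ⟨m, rfl⟩ : ∃ m, s = m * t := ⟨s / t, by field_simp⟩
  have hm1 : 1 ≤ m := by by_contra! h; nlinarith
  have hmp : m ≤ p := le_of_mul_le_mul_right hsp ht0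
  have hm0 : 0 < m := by linarith
  -- The point `l t = (l / m) (m t)` is a good dilate of both `t` and `m t`, so `γ t` and `γ (m t)`
  -- are compared through it. It exists because the two excluded sets have total measure below `1 /
  -- 2`, the second being stretched by `m ≤ p`.
  obtain ⟨l, hl, hl1, hl2⟩ : ∃ l ∈ Icc p (p + 1),
      l ∉ badSet γ η (p + 1) t ∧ m⁻¹ * l ∉ badSet γ η (p + 1) (m * t) := by
    by_contra! hcon
    have hsub : Icc p (p + 1) ⊆
        badSet γ η (p + 1) t ∪ (m⁻¹ * ·) ⁻¹' badSet γ η (p + 1) (m * t) := fun l hl => by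
      by_cases h : l ∈ badSet γ η (p + 1) t
      · exact Or.inl h
      · exact Or.inr (hcon l hl h)
    have h1 := (measure_mono (μ := volume) hsub).trans (measure_union_le _ _)
    rw [Real.volume_preimage_mul_left (inv_ne_zero hm0.ne'), Real.volume_Icc, inv_inv,
      abs_of_pos hm0] at h1
    have h2 : ENNReal.ofReal (p + 1 - p) < ENNReal.ofReal (1 / (2 * (p + 1))) +
        ENNReal.ofReal p * ENNReal.ofReal (1 / (2 * (p + 1))) := by
      refine h1.trans_lt (ENNReal.add_lt_add_of_lt_of_le ?_ (hT t htT).1 ?_)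
      · exact ENNReal.mul_ne_top ENNReal.ofReal_ne_top (hT (m * t) (by nlinarith)).1.ne_top
      · exact mul_le_mul' (ENNReal.ofReal_le_ofReal hmp) (hT (m * t) (by nlinarith)).1.le
    rw [← ENNReal.ofReal_mul (by linarith), ← ENNReal.ofReal_add (by positivity) (by positivity),
      ENNReal.ofReal_lt_ofReal_iff (by positivity)] at h2
    have h3 : 1 / (2 * (p + 1)) + p * (1 / (2 * (p + 1))) = 1 / 2 := by field_simp; ring
    linarith
  have hl0 : 0 < l := by linarith [hl.1]
  have b1 := hγ.bounds_of_notMem_badSet ht0 ⟨by linarith [hl.1], hl.2⟩ hl1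
  have hq : m⁻¹ * l ∈ Icc 1 (p + 1) := by
    rw [inv_mul_eq_div]
    exact ⟨(one_le_div hm0).2 (by linarith [hl.1]), (div_le_self hl0.le hm1).trans hl.2⟩
  have b2 := hγ.bounds_of_notMem_badSet (mul_pos hm0 ht0) hq hl2
  have e1 : m⁻¹ * l * (m * t) = l * t := by field_simp
  have hmη : 0 < m ^ η := Real.rpow_pos_of_pos hm0 η
  have hlη : 0 < l ^ η := Real.rpow_pos_of_pos hl0 η
  rw [e1, Real.mul_rpow (inv_nonneg.2 hm0.le) hl0.le, Real.inv_rpow hm0.le] at b2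
  have c1 : γ (m * t) ≤ 3 * m ^ η * γ t := by
    have h : 1 / 2 * ((m ^ η)⁻¹ * l ^ η) * γ (m * t) ≤ 3 / 2 * l ^ η * γ t := b2.2.trans b1.1
    have := mul_le_mul_of_nonneg_left h (by positivity : 0 ≤ 2 * m ^ η * (l ^ η)⁻¹)
    field_simp at this
    linarith
  have c2 : m ^ η * γ t ≤ 3 * γ (m * t) := by
    have h : 1 / 2 * l ^ η * γ t ≤ 3 / 2 * ((m ^ η)⁻¹ * l ^ η) * γ (m * t) := b1.2.trans b2.1
    have := mul_le_mul_of_nonneg_left h (by positivity : 0 ≤ 2 * m ^ η * (l ^ η)⁻¹)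
    field_simp at this
    linarith
  have hg := hγ.pos t ht0.le
  have hg' := hγ.pos (m * t) (by positivity)
  have hP : m ^ |η| ≤ p ^ |η| := Real.rpow_le_rpow hm0.le hmp (abs_nonneg _)
  have d1 : m ^ η ≤ p ^ |η| := (Real.rpow_le_rpow_of_exponent_le hm1 (le_abs_self η)).trans hP
  have d2 : 1 ≤ m ^ η * p ^ |η| := by
    calc 1 = m ^ η * m ^ (-η) := by rw [← Real.rpow_add hm0]; simp
      _ ≤ m ^ η * p ^ |η| := by
        gcongr
        exact (Real.rpow_le_rpow_of_exponent_le hm1 (neg_le_abs η)).trans hP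
  constructor
  · exact c1.trans (by gcongr)
  · calc γ t ≤ m ^ η * p ^ |η| * γ t := le_mul_of_one_le_left hg.le d2
      _ = p ^ |η| * (m ^ η * γ t) := by ring
      _ ≤ p ^ |η| * (3 * γ (m * t)) := by gcongr
      _ = 3 * p ^ |η| * γ (m * t) := by ring

/-- A regularly varying function of index `η` is dominated by every power of larger exponent. -/
theorem isBigO_rpow (hγ : IsRegularlyVarying γ η) {ρ : ℝ} (hρ : η < ρ) :
    ∃ K > 0, ∃ T > 0, ∀ t ≥ T, γ t ≤ K * t ^ ρ := by
  obtain ⟨C, hC, T₁, hT₁, hb⟩ := hγ.exists_uniform_bound (p := 2) (by norm_num)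
  have h2 : (2 : ℝ) ^ η < 2 ^ ρ := Real.rpow_lt_rpow_of_exponent_lt (by norm_num) hρ
  obtain ⟨T₂, hT₂⟩ := eventually_atTop.1 ((hγ.tendsto 2 (by norm_num)).eventually_le_const h2)
  set T := max T₁ T₂ with hT
  have hT0 : 0 < T := lt_of_lt_of_le hT₁ (le_max_left _ _)
  -- The minimum bounds `t ^ ρ` from below on `[T, 2 T]` for either sign of `ρ`.
  have hmin : 0 < min (T ^ ρ) ((2 * T) ^ ρ) := by positivity
  refine ⟨C * γ T / min (T ^ ρ) ((2 * T) ^ ρ), div_pos (mul_pos hC (hγ.pos T hT0.le)) hmin, T, hT0,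
    fun t ht => ?_⟩
  set K := C * γ T / min (T ^ ρ) ((2 * T) ^ ρ) with hK
  have hK0 : 0 < K := div_pos (mul_pos hC (hγ.pos T hT0.le)) hmin
  -- Past `T`, doubling the argument multiplies `γ` by at most `2 ^ ρ`, so the bound spreads from
  -- `[T, 2 T]` by dyadic induction.
  have main : ∀ n : ℕ, ∀ t ≥ T, t ≤ 2 ^ n * (2 * T) → γ t ≤ K * t ^ ρ := by
    intro n
    induction n with
    | zero =>
      intro t ht htn
      rw [pow_zero, one_mul] at htn
      have h1 := (hb T (le_max_left _ _) t ht htn).1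
      have h3 : min (T ^ ρ) ((2 * T) ^ ρ) ≤ t ^ ρ := by
        rcases le_total 0 ρ with h | h
        · exact (min_le_left _ _).trans (Real.rpow_le_rpow hT0.le ht h)
        · exact (min_le_right _ _).trans
            (Real.rpow_le_rpow_of_nonpos (hT0.trans_le ht) htn h)
      calc γ t ≤ C * γ T := h1
        _ = K * min (T ^ ρ) ((2 * T) ^ ρ) := by rw [hK]; field_simp
        _ ≤ K * t ^ ρ := by gcongr
    | succ n ih =>
      intro t ht htn
      by_cases h : t ≤ 2 ^ n * (2 * T)
      · exact ih t ht h
      have hge : T ≤ t / 2 := by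
        have : (1 : ℝ) ≤ 2 ^ n := one_le_pow₀ (by norm_num)
        nlinarith
      have h4 := ih (t / 2) hge (by rw [pow_succ] at htn; linarith)
      have h5 := hT₂ (t / 2) ((le_max_right _ _).trans hge)
      have ht0 : 0 < t / 2 := hT0.trans_le hge
      rw [div_le_iff₀ (hγ.pos _ ht0.le), mul_div_cancel₀ t two_ne_zero] at h5
      calc γ t ≤ 2 ^ ρ * γ (t / 2) := h5
        _ ≤ 2 ^ ρ * (K * (t / 2) ^ ρ) := by gcongr
        _ = K * (2 * (t / 2)) ^ ρ := by rw [Real.mul_rpow (by norm_num) ht0.le]; ring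
        _ = K * t ^ ρ := by rw [mul_div_cancel₀ t two_ne_zero]
  obtain ⟨n, hn⟩ := pow_unbounded_of_one_lt (t / (2 * T)) one_lt_two
  exact main n t ht ((div_le_iff₀ (by positivity)).1 hn.le)

end IsRegularlyVarying

/-! ### The scalar equation `w' = -w - g` -/

/-- The function `exp u * (w u - m)` has derivative `exp u * (-g u - m) ≤ 0`. -/
lemma le_exp_mul_abs_add {w g : ℝ → ℝ} {s t m : ℝ}
    (hw : ∀ u ∈ Icc s t, HasDerivWithinAt w (-w u - g u) (Icc s t) u) (hst : s ≤ t)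
    (hg : ∀ u ∈ Icc s t, |g u| ≤ m) : w t ≤ Real.exp (-(t - s)) * |w s| + m := by
  have hd : ∀ u ∈ Icc s t, HasDerivWithinAt (fun u => Real.exp u * (w u - m))
      (Real.exp u * (w u - m) + Real.exp u * (-w u - g u)) (Icc s t) u := fun u hu =>
    (Real.hasDerivAt_exp u).hasDerivWithinAt.mul ((hw u hu).sub_const m)
  have hanti : AntitoneOn (fun u => Real.exp u * (w u - m)) (Icc s t) := by
    refine antitoneOn_of_hasDerivWithinAt_nonpos (convex_Icc s t)
      (fun u hu => (hd u hu).continuousWithinAt)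
      (fun u hu => (hd u (interior_subset hu)).mono interior_subset) fun u hu => ?_
    have h1 := (abs_le.1 (hg u (interior_subset hu))).1
    rw [← mul_add]
    exact mul_nonpos_of_nonneg_of_nonpos (Real.exp_pos u).le (by linarith)
  have h := hanti (left_mem_Icc.2 hst) (right_mem_Icc.2 hst) hst
  have hm : 0 ≤ m := (abs_nonneg _).trans (hg s (left_mem_Icc.2 hst))
  have h2 := mul_le_mul_of_nonneg_left h (Real.exp_pos (-t)).le
  simp only [← mul_assoc, ← Real.exp_add] at h2
  rw [neg_add_cancel, Real.exp_zero, one_mul, show -t + s = -(t - s) by ring, mul_sub] at h2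
  have h3 : Real.exp (-(t - s)) * w s ≤ Real.exp (-(t - s)) * |w s| := by
    gcongr; exact le_abs_self _
  have h4 : 0 ≤ Real.exp (-(t - s)) * m := by positivity
  linarith

lemma abs_le_exp_mul_abs_add {w g : ℝ → ℝ} {s t m : ℝ}
    (hw : ∀ u ∈ Icc s t, HasDerivWithinAt w (-w u - g u) (Icc s t) u) (hst : s ≤ t)
    (hg : ∀ u ∈ Icc s t, |g u| ≤ m) : |w t| ≤ Real.exp (-(t - s)) * |w s| + m := by
  refine abs_le'.2 ⟨le_exp_mul_abs_add hw hst hg, ?_⟩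
  have := le_exp_mul_abs_add (w := fun u => -w u) (g := fun u => -g u) (s := s) (t := t) (m := m)
    (fun u hu => by
      have := (hw u hu).neg
      rwa [show -(-w u - g u) = -(-w u) - -g u by ring] at this)
    hst (fun u hu => by rw [abs_neg]; exact hg u hu)
  simpa using this

/-! ### A scalar recurrence with proportional delay -/

lemma exists_le_pow_mul {q : ℝ} (hq0 : 0 < q) (hq1 : q < 1) (t : ℝ) {c : ℝ} (hc : 0 < c) :
    ∃ n : ℕ, q ^ n * t ≤ c := by
  have h : Tendsto (fun n : ℕ => q ^ n * t) atTop (𝓝 (0 * t)) :=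
    (tendsto_pow_atTop_nhds_zero_of_lt_one hq0.le hq1).mul_const t
  rw [zero_mul] at h
  exact ((h.eventually_lt_const hc).exists).imp fun n hn => hn.le

/-- The level `R + 2 δ` is preserved by `r ↦ r / 2 + δ`. The induction counts the multiplications by
`q` that bring `t` below `T`. -/
lemma bounded_of_recurrence {q T R δ : ℝ} {r : ℝ → ℝ} (hq0 : 0 < q) (hq1 : q < 1) (hT : 0 < T)
    (hδ : 0 ≤ δ) (hR : 0 ≤ R) (h0 : ∀ t ∈ Icc (q * T) T, r t ≤ R)
    (hr : ∀ t ≥ T, r t ≤ r (q * t) / 2 + δ) {t : ℝ} (ht : q * T ≤ t) : r t ≤ R + 2 * δ := by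
  have main : ∀ n : ℕ, ∀ t ≥ q * T, q ^ n * t ≤ T → r t ≤ R + 2 * δ := by
    intro n
    induction n with
    | zero =>
      intro t ht htn
      linarith [h0 t ⟨ht, by simpa using htn⟩]
    | succ n ih =>
      intro t ht htn
      rcases le_total t T with h | h
      · linarith [h0 t ⟨ht, h⟩]
      · have := ih (q * t) (by nlinarith) (by rw [pow_succ] at htn; linarith)
        linarith [hr t h]
  obtain ⟨n, hn⟩ := exists_le_pow_mul hq0 hq1 t hT
  exact main n t ht hn

/-- Each use of the recurrence halves the a priori bound `B`, while the accumulated errors stay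
below `2 ε`. -/
lemma tendsto_zero_of_recurrence {q B : ℝ} {r : ℝ → ℝ} (hq0 : 0 < q)
    (hr0 : ∀ᶠ t in atTop, 0 ≤ r t) (hB : ∀ᶠ t in atTop, r t ≤ B)
    (hr : ∀ ε > 0, ∀ᶠ t in atTop, r t ≤ r (q * t) / 2 + ε) : Tendsto r atTop (𝓝 0) := by
  have main : ∀ ε > 0, ∀ n : ℕ, ∀ᶠ t in atTop, r t ≤ B / 2 ^ n + 2 * ε := by
    intro ε hε n
    induction n with
    | zero => filter_upwards [hB] with _ ht; simp; linarith
    | succ n ih =>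
      have hq : Tendsto (fun t => q * t) atTop atTop := tendsto_id.const_mul_atTop hq0
      filter_upwards [hq.eventually ih, hr ε hε] with t h1 h2
      rw [pow_succ, ← div_div]
      linarith
  refine tendsto_order.2 ⟨fun c hc => hr0.mono fun _ ht => hc.trans_le ht, fun c hc => ?_⟩
  have h : Tendsto (fun n : ℕ => B / 2 ^ n) atTop (𝓝 0) :=
    tendsto_const_nhds.div_atTop (tendsto_pow_atTop_atTop_of_one_lt one_lt_two)
  obtain ⟨n, hn⟩ := (h.eventually_lt_const (half_pos hc)).exists
  filter_upwards [main (c / 8) (by positivity) n] with t ht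
  linarith

/-! ### Regularly varying rates for `w' = -w - g` -/

namespace IsRegularlyVarying

variable {γ : ℝ → ℝ} {η : ℝ}

lemma eventually_pos (hγ : IsRegularlyVarying γ η) : ∀ᶠ t in atTop, 0 < γ t :=
  (eventually_ge_atTop 0).mono hγ.pos

lemma isBigO_comp_mul (hγ : IsRegularlyVarying γ η) {q : ℝ} (hq0 : 0 < q) :
    (fun t => γ (q * t)) =O[atTop] γ :=
  isBigO_of_div_tendsto_nhds (hγ.eventually_pos.mono fun _ ht h => absurd h ht.ne') _
    (hγ.tendsto q hq0)

/-- Two-sided bounds on the intervals `[q t, t]`. -/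
lemma exists_bound_Icc (hγ : IsRegularlyVarying γ η) {q : ℝ} (hq0 : 0 < q) (hq1 : q < 1) :
    ∃ C > 0, ∃ T > 0, ∀ t ≥ T, ∀ s ∈ Icc (q * t) t, γ s ≤ C * γ t ∧ γ t ≤ C * γ s := by
  obtain ⟨C, hC, T, hT, h⟩ := hγ.exists_uniform_bound ((one_lt_inv₀ hq0).2 hq1)
  refine ⟨C, hC, T / q, by positivity, fun t ht s hs => (h s ?_ t hs.2 ?_).symm⟩
  · have := (div_le_iff₀ hq0).1 ht
    linarith [hs.1]
  · rw [inv_mul_eq_div, le_div_iff₀ hq0]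
    linarith [hs.1]

/-- Over `[q t, t]` the initial value is damped by `exp (-(1 - q) t)`, which eventually outweighs
the constant comparing `γ (q t)` with `γ t`. The threshold for `t` precedes `D`, so `D` may be a
fixed constant (for `O`) or arbitrarily small (for `o`). -/
lemma exists_ratio_recurrence (hγ : IsRegularlyVarying γ η) {q : ℝ} (hq0 : 0 < q) (hq1 : q < 1)
    {w g : ℝ → ℝ} (hw : ∀ t, 0 ≤ t → HasDerivWithinAt w (-w t - g t) (Ici 0) t) :
    ∃ C > 0, ∀ᶠ t in atTop, ∀ D ≥ 0, (∀ s ∈ Icc (q * t) t, |g s| ≤ D * γ s) →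
      |w t| / γ t ≤ |w (q * t)| / γ (q * t) / 2 + C * D := by
  obtain ⟨C, hC, T, hT, h⟩ := hγ.exists_bound_Icc hq0 hq1
  have hexp : Tendsto (fun t => C * Real.exp (-((1 - q) * t))) atTop (𝓝 (C * 0)) :=
    (Real.tendsto_exp_neg_atTop_nhds_zero.comp
      (tendsto_id.const_mul_atTop (by linarith : 0 < 1 - q))).const_mul C
  rw [mul_zero] at hexp
  refine ⟨C, hC, ?_⟩
  filter_upwards [hexp.eventually_lt_const (by norm_num : (0 : ℝ) < 1 / 2),
    eventually_ge_atTop T] with t ht htT D hD hg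
  have ht0 : 0 < t := hT.trans_le htT
  have hqt : q * t ≤ t := by nlinarith
  have hqt0 : 0 < q * t := by positivity
  have hγt := hγ.pos t ht0.le
  have hγq := hγ.pos _ hqt0.le
  have h1 := abs_le_exp_mul_abs_add (w := w) (g := g) (m := D * (C * γ t)) (s := q * t) (t := t)
    (fun u hu => (hw u (hqt0.le.trans hu.1)).mono fun v hv => hqt0.le.trans hv.1) hqt
    (fun u hu => (hg u hu).trans (by gcongr; exact (h t htT u hu).1))
  rw [show t - q * t = (1 - q) * t by ring] at h1
  set E := Real.exp (-((1 - q) * t)) with hE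
  have hE0 : 0 < E := Real.exp_pos _
  have h2 : γ (q * t) ≤ C * γ t := (h t htT _ ⟨le_rfl, hqt⟩).1
  rw [div_le_iff₀ hγt]
  set ρ := |w (q * t)| / γ (q * t) with hρ
  have hρ0 : 0 ≤ ρ := by positivity
  have e : |w (q * t)| = ρ * γ (q * t) := by rw [hρ]; field_simp
  calc |w t| ≤ E * |w (q * t)| + D * (C * γ t) := h1
    _ = E * (ρ * γ (q * t)) + D * (C * γ t) := by rw [e]
    _ ≤ E * (ρ * (C * γ t)) + D * (C * γ t) := by gcongr
    _ = (C * E) * (ρ * γ t) + D * (C * γ t) := by ring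
    _ ≤ 1 / 2 * (ρ * γ t) + D * (C * γ t) := by gcongr
    _ = (ρ / 2 + C * D) * γ t := by ring

lemma eventually_forall_Icc {q : ℝ} (hq0 : 0 < q) {P : ℝ → Prop} (hP : ∀ᶠ t in atTop, P t) :
    ∀ᶠ t in atTop, ∀ s ∈ Icc (q * t) t, P s := by
  obtain ⟨T, hT⟩ := eventually_atTop.1 hP
  filter_upwards [(tendsto_id.const_mul_atTop hq0).eventually_ge_atTop T] with t ht s hs
  exact hT s (le_trans ht hs.1)

theorem isBigO_of_hasDerivWithinAt (hγ : IsRegularlyVarying γ η) {w g : ℝ → ℝ}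
    (hw : ∀ t, 0 ≤ t → HasDerivWithinAt w (-w t - g t) (Ici 0) t) (hg : g =O[atTop] γ) :
    w =O[atTop] γ := by
  -- The window ratio `1 / 2` is an arbitrary number in `(0, 1)`, unrelated to the delay.
  have hq0 : (0 : ℝ) < 1 / 2 := by norm_num
  have hq1 : (1 / 2 : ℝ) < 1 := by norm_num
  obtain ⟨D, hD, hgD⟩ := hg.exists_pos
  obtain ⟨C, hC, hrec⟩ := hγ.exists_ratio_recurrence hq0 hq1 hw
  obtain ⟨C', hC', T', hT', h'⟩ := hγ.exists_bound_Icc hq0 hq1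
  have hgD' : ∀ᶠ t in atTop, |g t| ≤ D * γ t := by
    filter_upwards [hgD.bound, hγ.eventually_pos] with t ht hp
    simpa [abs_of_pos hp] using ht
  obtain ⟨T₁, hT₁⟩ := eventually_atTop.1 (hrec.and (eventually_forall_Icc hq0 hgD'))
  set T := max T₁ T'
  have hT : 0 < T := hT'.trans_le (le_max_right _ _)
  have hqT : 0 < 1 / 2 * T := by positivity
  have hcont : ContinuousOn w (Icc (1 / 2 * T) T) := fun u hu =>
    ((hw u (hqT.le.trans hu.1)).mono fun v hv => hqT.le.trans hv.1).continuousWithinAt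
  obtain ⟨M, hM⟩ := isCompact_Icc.exists_bound_of_continuousOn hcont
  have hM0 : 0 ≤ M := (norm_nonneg _).trans (hM T ⟨by linarith, le_rfl⟩)
  have hγT := hγ.pos T hT.le
  have hbd : ∀ t ≥ 1 / 2 * T, |w t| / γ t ≤ M * (C' / γ T) + 2 * (C * D) := fun t ht => by
    refine bounded_of_recurrence (r := fun t => |w t| / γ t) (δ := C * D) hq0 hq1 hT (by positivity)
      (by positivity) (fun s hs => ?_) (fun s hs => ?_) ht
    · have hγs := hγ.pos s (hqT.le.trans hs.1)
      have h1 := (h' T (le_max_right _ _) s hs).2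
      have h2 : |w s| ≤ M := hM s hs
      rw [div_le_iff₀ hγs]
      calc |w s| ≤ M * 1 := by linarith
        _ ≤ M * (C' * γ s / γ T) := by
          gcongr
          rwa [one_le_div hγT]
        _ = M * (C' / γ T) * γ s := by ring
    · have h3 := hT₁ s ((le_max_left _ _).trans hs)
      exact h3.1 D hD.le h3.2
  refine IsBigO.of_bound (M * (C' / γ T) + 2 * (C * D)) ?_
  filter_upwards [eventually_ge_atTop (1 / 2 * T), hγ.eventually_pos] with t ht hp
  rw [Real.norm_eq_abs, Real.norm_of_nonneg hp.le, ← div_le_iff₀ hp]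
  exact hbd t ht

theorem isLittleO_of_hasDerivWithinAt (hγ : IsRegularlyVarying γ η) {w g : ℝ → ℝ}
    (hw : ∀ t, 0 ≤ t → HasDerivWithinAt w (-w t - g t) (Ici 0) t) (hg : g =o[atTop] γ) :
    w =o[atTop] γ := by
  have hq0 : (0 : ℝ) < 1 / 2 := by norm_num
  have hq1 : (1 / 2 : ℝ) < 1 := by norm_num
  obtain ⟨C, hC, hrec⟩ := hγ.exists_ratio_recurrence hq0 hq1 hw
  obtain ⟨B, hB⟩ := (hγ.isBigO_of_hasDerivWithinAt hw hg.isBigO).bound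
  have hlim : Tendsto (fun t => |w t| / γ t) atTop (𝓝 0) := by
    refine tendsto_zero_of_recurrence (q := 1 / 2) (B := B) hq0 ?_ ?_ fun ε hε => ?_
    · filter_upwards [hγ.eventually_pos] with t hp
      positivity
    · filter_upwards [hγ.eventually_pos, hB] with t hp hb
      rw [div_le_iff₀ hp]
      simpa [abs_of_pos hp] using hb
    · have hgε : ∀ᶠ t in atTop, |g t| ≤ ε / C * γ t := by
        filter_upwards [hg.bound (div_pos hε hC), hγ.eventually_pos] with t ht hp
        simpa [abs_of_pos hp] using ht
      filter_upwards [hrec, eventually_forall_Icc hq0 hgε] with t h1 h2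
      have := h1 (ε / C) (by positivity) h2
      rwa [mul_div_cancel₀ ε hC.ne'] at this
  refine (isLittleO_iff_tendsto' (hγ.eventually_pos.mono fun _ ht h => absurd h ht.ne')).2 ?_
  refine (tendsto_zero_iff_abs_tendsto_zero _).2 (hlim.congr' ?_)
  filter_upwards [hγ.eventually_pos] with t hp
  simp [abs_div, abs_of_pos hp]

end IsRegularlyVarying

/-! ### Transfer of rates from `x` to `y` -/

section Auxiliary

variable {a b q ζ η : ℝ} {f x y γ : ℝ → ℝ}

lemma IsForcedSolution.hasDerivWithinAt_sub (hx : IsForcedSolution a b q f ζ x)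
    (hy : IsAuxiliarySolution f y) (t : ℝ) (ht : 0 ≤ t) :
    HasDerivWithinAt (fun t => y t - x t)
      (-(y t - x t) - ((1 + b) * x t + a * x (q * t))) (Ici 0) t := by
  exact ((hy.deriv t ht).sub (hx.deriv t ht)).congr_deriv (by ring)

theorem isBigO_auxiliary_of_isBigO (hq0 : 0 < q) (hx : IsForcedSolution a b q f ζ x)
    (hy : IsAuxiliarySolution f y) (hγ : IsRegularlyVarying γ η) (h : x =O[atTop] γ) :
    y =O[atTop] γ := by
  have hq : (fun t => x (q * t)) =O[atTop] γ :=
    (h.comp_tendsto (tendsto_id.const_mul_atTop hq0)).trans (hγ.isBigO_comp_mul hq0)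
  have := hγ.isBigO_of_hasDerivWithinAt (hx.hasDerivWithinAt_sub hy)
    ((h.const_mul_left (1 + b)).add (hq.const_mul_left a))
  simpa using this.add h

theorem isLittleO_auxiliary_of_isLittleO (hq0 : 0 < q) (hx : IsForcedSolution a b q f ζ x)
    (hy : IsAuxiliarySolution f y) (hγ : IsRegularlyVarying γ η) (h : x =o[atTop] γ) :
    y =o[atTop] γ := by
  have hq : (fun t => x (q * t)) =o[atTop] γ :=
    (h.comp_tendsto (tendsto_id.const_mul_atTop hq0)).trans_isBigO (hγ.isBigO_comp_mul hq0)
  have := hγ.isLittleO_of_hasDerivWithinAt (hx.hasDerivWithinAt_sub hy)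
    ((h.const_mul_left (1 + b)).add (hq.const_mul_left a))
  simpa using this.add h

lemma IsRegularlyVarying.limsupRatio_eq_zero_iff (hγ : IsRegularlyVarying γ η) (u : ℝ → ℝ) :
    limsupRatio u γ = 0 ↔ u =o[atTop] γ := by
  have hp := hγ.eventually_pos
  rw [isLittleO_iff_tendsto' (hp.mono fun t ht h => absurd h ht.ne'),
    tendsto_zero_iff_abs_tendsto_zero]
  have e : (abs ∘ fun t => u t / γ t) =ᶠ[atTop] fun t => |u t| / γ t := by
    filter_upwards [hp] with t ht
    simp [abs_div, abs_of_pos ht]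
  rw [tendsto_congr' e]
  constructor
  · intro h
    have h1 : Tendsto (fun t => ENNReal.ofReal (|u t| / γ t)) atTop (𝓝 0) :=
      tendsto_of_le_liminf_of_limsup_le bot_le h.le
    have h2 := (ENNReal.tendsto_toReal ENNReal.zero_ne_top).comp h1
    refine h2.congr' ?_
    filter_upwards [hp] with t ht
    simp only [Function.comp_apply]
    rw [ENNReal.toReal_ofReal (by positivity)]
  · intro h
    have := ENNReal.tendsto_ofReal h
    rw [ENNReal.ofReal_zero] at this
    exact this.limsup_eq

/-- Contrapositive of the `o(γ)` transfer, since a zero limsup means `o(γ)`. -/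
theorem limsupRatio_pos_of_auxiliary (hq0 : 0 < q) (hx : IsForcedSolution a b q f ζ x)
    (hy : IsAuxiliarySolution f y) (hγ : IsRegularlyVarying γ η) (h : 0 < limsupRatio y γ) :
    0 < limsupRatio x γ := by
  rw [pos_iff_ne_zero, ne_eq, hγ.limsupRatio_eq_zero_iff] at h ⊢
  exact fun hxo => h (isLittleO_auxiliary_of_isLittleO hq0 hx hy hγ hxo)

end Auxiliary

/-! ### Comparison with a barrier -/

section Barrier

variable {a b q κ : ℝ} {z g : ℝ → ℝ}

/-- A trajectory of `z' = a z(q ·) + b z + g` touching `t ^ κ h t` from below at `t = t₀`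
is impossible under a strict differential inequality for `h`. -/
lemma not_touches_barrier {t₀ N G : ℝ} (ht₀ : 0 < t₀) (hq0 : 0 < q)
    (hq1 : q < 1) (hκq : |a| * q ^ κ = -b) (hneg : b - κ / t₀ ≤ 0)
    (hz : HasDerivAt z (a * z (q * t₀) + b * z t₀ + g t₀) t₀)
    {h : ℝ} (hN : |z (q * t₀)| ≤ (q * t₀) ^ κ * N) (hG : |g t₀| ≤ t₀ ^ κ * G)
    (hbar : G < -b * (h - N) + κ * h / t₀)
    (hh : t₀ ^ κ * h ≤ z t₀)
    (hle : ∀ s ∈ Ico (q * t₀) t₀, z s / s ^ κ ≤ z t₀ / t₀ ^ κ) : False := by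
  have hp : 0 < t₀ ^ κ := Real.rpow_pos_of_pos ht₀ κ
  have hq : 0 < q ^ κ := Real.rpow_pos_of_pos hq0 κ
  have hqt : q * t₀ < t₀ := by nlinarith
  have hd := hz.div (Real.hasDerivAt_rpow_const (p := κ) (Or.inl ht₀.ne')) hp.ne'
  -- By `hle`, the left slopes of `z s / s ^ κ` at `t₀` are nonnegative, hence so is its derivative
  -- there.
  have hnn : 0 ≤ ((a * z (q * t₀) + b * z t₀ + g t₀) * t₀ ^ κ - z t₀ * (κ * t₀ ^ (κ - 1))) /
      (t₀ ^ κ) ^ 2 := by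
    refine ge_of_tendsto ((hasDerivAt_iff_tendsto_slope_left_right.1 hd).1) ?_
    filter_upwards [Ico_mem_nhdsLT hqt] with s hs
    rw [slope_def_field]
    exact div_nonneg_of_nonpos (sub_nonpos.2 (hle s hs)) (sub_nonpos.2 hs.2.le)
  rw [Real.rpow_sub_one ht₀.ne', le_div_iff₀ (by positivity), zero_mul] at hnn
  have h1 : 0 ≤ a * z (q * t₀) + g t₀ + (b - κ / t₀) * z t₀ := by
    refine nonneg_of_mul_nonneg_left (b := t₀ ^ κ) ?_ hp
    calc 0 ≤ _ := hnn
      _ = _ := by field_simp; ring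
  have h2 : a * z (q * t₀) ≤ -b * (t₀ ^ κ * N) := by
    calc a * z (q * t₀) ≤ |a| * |z (q * t₀)| := by rw [← abs_mul]; exact le_abs_self _
      _ ≤ |a| * ((q * t₀) ^ κ * N) := by gcongr
      _ = -b * (t₀ ^ κ * N) := by rw [Real.mul_rpow hq0.le ht₀.le, ← hκq]; ring
  have h3 : (b - κ / t₀) * z t₀ ≤ (b - κ / t₀) * (t₀ ^ κ * h) :=
    mul_le_mul_of_nonpos_left hh hneg
  have h4 := (le_abs_self (g t₀)).trans hG
  have h5 := mul_lt_mul_of_pos_left hbar hp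
  have e : t₀ ^ κ * (-b * (h - N) + κ * h / t₀) =
    -b * (t₀ ^ κ * h) + b * (t₀ ^ κ * N) + κ / t₀ * (t₀ ^ κ * h) := by ring
  rw [e] at h5
  linarith

/-- At a first touching time `t₀`, monotonicity of `h` makes `|z s| / s ^ κ` on `[q t₀, t₀]` largest
at `t₀`. Then `not_touches_barrier` applies to `z` or to `-z`, according to the sign of `z t₀`. -/
lemma abs_lt_barrier {h G : ℝ → ℝ} {T : ℝ} (hT : 0 < T) (hq0 : 0 < q)
    (hq1 : q < 1) (hκq : |a| * q ^ κ = -b) (hneg : ∀ t ≥ T, b - κ / t ≤ 0)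
    (hz : ∀ t > 0, HasDerivAt z (a * z (q * t) + b * z t + g t) t)
    (hmono : MonotoneOn h (Ici (q * T))) (hcont : ContinuousOn h (Ici (q * T)))
    (hG : ∀ t ≥ T, |g t| ≤ t ^ κ * G t)
    (hbar : ∀ t ≥ T, G t < -b * (h t - h (q * t)) + κ * h t / t)
    (hinit : ∀ t ∈ Icc (q * T) T, |z t| < t ^ κ * h t) {t : ℝ} (ht : q * T ≤ t) :
    |z t| < t ^ κ * h t := by
  by_contra! hcon
  have hqT : 0 < q * T := by positivity
  have hqTT : q * T ≤ T := by nlinarith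
  have hTt : T < t := by
    by_contra! hle
    exact absurd (hinit t ⟨ht, hle⟩) (not_lt.2 hcon)
  set S := {s ∈ Icc T t | s ^ κ * h s - |z s| ≤ 0} with hS
  have hSc : IsCompact S := by
    refine isCompact_Icc.of_isClosed_subset ?_ (sep_subset _ _)
    refine ContinuousOn.preimage_isClosed_of_isClosed (f := fun s => s ^ κ * h s - |z s|)
      (t := Iic 0) ?_ isClosed_Icc isClosed_Iic
    refine ContinuousOn.sub (ContinuousOn.mul ?_ ?_) ?_
    · exact fun s hs => (Real.continuousAt_rpow_const s κ
        (Or.inl (hT.trans_le hs.1).ne')).continuousWithinAt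
    · exact hcont.mono fun s hs => hqTT.trans hs.1
    · exact fun s hs => (hz s (hT.trans_le hs.1)).continuousAt.continuousWithinAt.abs
  obtain ⟨t₀, ht₀S, hmin⟩ := hSc.exists_isLeast ⟨t, ⟨hTt.le, le_rfl⟩, by linarith⟩
  have hTt₀ : T ≤ t₀ := ht₀S.1.1
  have ht₀ : 0 < t₀ := hT.trans_le hTt₀
  have hge : t₀ ^ κ * h t₀ ≤ |z t₀| := by linarith [ht₀S.2]
  have hbefore : ∀ s ∈ Ico (q * T) t₀, |z s| < s ^ κ * h s := fun s hs => by
    by_contra! hc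
    rcases le_or_gt s T with h1 | h1
    · exact absurd (hinit s ⟨hs.1, h1⟩) (not_lt.2 hc)
    · exact absurd (hmin ⟨⟨h1.le, hs.2.le.trans ht₀S.1.2⟩, by linarith⟩) (not_le.2 hs.2)
  have hqt₀ : q * t₀ < t₀ := by nlinarith
  have hqTt₀ : q * T ≤ q * t₀ := by gcongr
  have hle : ∀ s ∈ Ico (q * t₀) t₀, |z s| / s ^ κ ≤ |z t₀| / t₀ ^ κ := fun s hs => by
    have hs0 : 0 < s := hqT.trans_le (hqTt₀.trans hs.1)
    have hsκ := Real.rpow_pos_of_pos hs0 κ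
    have htκ := Real.rpow_pos_of_pos ht₀ κ
    calc |z s| / s ^ κ ≤ h s := by
          rw [div_le_iff₀ hsκ, mul_comm]
          exact (hbefore s ⟨hqTt₀.trans hs.1, hs.2⟩).le
      _ ≤ h t₀ := hmono (hqTt₀.trans hs.1) (hqTT.trans hTt₀) hs.2.le
      _ ≤ |z t₀| / t₀ ^ κ := by rw [le_div_iff₀ htκ, mul_comm]; exact hge
  have hN := (hbefore (q * t₀) ⟨hqTt₀, hqt₀⟩).le
  rcases le_total 0 (z t₀) with h0 | h0
  · rw [abs_of_nonneg h0] at hge hle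
    refine not_touches_barrier ht₀ hq0 hq1 hκq (hneg t₀ hTt₀) (hz t₀ ht₀) hN (hG t₀ hTt₀)
      (hbar t₀ hTt₀) hge fun s hs => le_trans ?_ (hle s hs)
    have : 0 < s := hqT.trans_le (hqTt₀.trans hs.1)
    gcongr
    exact le_abs_self _
  · rw [abs_of_nonpos h0] at hge hle
    refine not_touches_barrier (z := fun s => -z s) (g := fun s => -g s) ht₀ hq0 hq1 hκq
      (hneg t₀ hTt₀) ((hz t₀ ht₀).neg.congr_deriv (by ring)) (by simpa using hN)
      (by simpa using hG t₀ hTt₀) (hbar t₀ hTt₀) hge fun s hs => le_trans ?_ (hle s hs)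
    have : 0 < s := hqT.trans_le (hqTt₀.trans hs.1)
    gcongr
    exact neg_le_abs _

/-- Growth bound for `z' = a z(q ·) + b z + g` when `g` is controlled by the increments of `J`. -/
theorem exists_bound_of_increments {J : ℝ → ℝ} (hq0 : 0 < q) (hq1 : q < 1) (hb : b < 0)
    (hκq : |a| * q ^ κ = -b) (hκ : κ < 0)
    (hz : ∀ t > 0, HasDerivAt z (a * z (q * t) + b * z t + g t) t)
    (hJ0 : ∀ t ≥ 1, 0 ≤ J t) (hmono : MonotoneOn J (Ici 1)) (hcont : ContinuousOn J (Ici 1))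
    (hg : ∀ᶠ t in atTop, |g t| ≤ t ^ κ * (J t - J (q * t))) :
    ∃ K > 0, ∀ᶠ t in atTop, |z t| ≤ K * (t ^ κ * (1 + J t)) := by
  have hb' : 0 < -b := by linarith
  have hr : 0 < q⁻¹ - 1 := by linarith [(one_lt_inv₀ hq0).2 hq1]
  -- From `q t` to `t` the factor `1 - c / t` grows by `c (q⁻¹ - 1) / t`. With this `c` the growth,
  -- times `-b`, absorbs the negative term `κ / t` and leaves `1 / t`, which makes the barrier
  -- strict.
  obtain ⟨c, hc, hcb⟩ : ∃ c > 0, -b * c * (q⁻¹ - 1) = 1 - κ :=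
    ⟨(1 - κ) / (-b * (q⁻¹ - 1)), div_pos (by linarith) (by positivity), by
      rw [mul_right_comm, mul_div_cancel₀ _ (by positivity)]⟩
  have hinv : Tendsto (fun t : ℝ => t⁻¹) atTop (𝓝 0) := tendsto_inv_atTop_zero
  have hc1 : ∀ᶠ t : ℝ in atTop, c * q⁻¹ * t⁻¹ < 1 / 2 := by
    have := hinv.const_mul (c * q⁻¹)
    rw [mul_zero] at this
    exact this.eventually_lt_const (by norm_num)
  have hc2 : ∀ᶠ t : ℝ in atTop, (-b * c - κ) * t⁻¹ < -b / 2 := by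
    have := hinv.const_mul (-b * c - κ)
    rw [mul_zero] at this
    exact this.eventually_lt_const (by linarith)
  obtain ⟨T, hTall⟩ := eventually_atTop.1
    (((hc1.and hc2).and hg).and (eventually_ge_atTop q⁻¹))
  have hTq : q⁻¹ ≤ T := (hTall T le_rfl).2
  have hT : 0 < T := (inv_pos.2 hq0).trans_le hTq
  have hqT1 : 1 ≤ q * T := by rwa [← inv_mul_le_iff₀ hq0, mul_one]
  have hqT : 0 < q * T := by positivity
  have hhalf : ∀ t ≥ q * T, 1 / 2 ≤ 1 - c * t⁻¹ := fun t ht => by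
    have h1 := (hTall T le_rfl).1.1.1
    have h2 : t⁻¹ ≤ (q * T)⁻¹ := inv_anti₀ hqT ht
    have h3 : c * t⁻¹ ≤ c * (q * T)⁻¹ := by gcongr
    rw [mul_inv, ← mul_assoc] at h3
    linarith
  have hzc : ContinuousOn z (Icc (q * T) T) := fun u hu =>
    (hz u (hqT.trans_le hu.1)).continuousAt.continuousWithinAt
  have hpc : ContinuousOn (fun u : ℝ => |z u| / u ^ κ) (Icc (q * T) T) := by
    refine hzc.abs.div (fun u hu => ?_) fun u hu =>
      (Real.rpow_pos_of_pos (hqT.trans_le hu.1) κ).ne'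
    exact (Real.continuousAt_rpow_const u κ (Or.inl (hqT.trans_le hu.1).ne')).continuousWithinAt
  obtain ⟨M, hM⟩ := isCompact_Icc.exists_bound_of_continuousOn hpc
  -- The `2` compensates `1 - c / t ≥ 1 / 2`, so the barrier starts above `|z|` on `[q T, T]`.
  set K := 2 * (|M| + 1) with hK
  have hK0 : 0 < K := by positivity
  -- By `hc2`, increments of `N` enter the barrier inequality with coefficient at least `-b / 2`;
  -- this `m` turns that into the increment of `J`.
  set m := 2 / -b with hm
  have hm0 : 0 < m := by positivity
  set N : ℝ → ℝ := fun t => K + m * J t with hN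
  have hNpos : ∀ t ≥ q * T, K ≤ N t := fun t ht => by
    have := mul_nonneg hm0.le (hJ0 t (hqT1.trans ht))
    simp only [hN]; linarith
  set h : ℝ → ℝ := fun t => (1 - c * t⁻¹) * N t with hh
  have hNmono : MonotoneOn N (Ici (q * T)) := fun s hs t ht hst => by
    have := hmono (hqT1.trans hs) (hqT1.trans ht) hst
    simp only [hN]; gcongr
  have hhmono : MonotoneOn h (Ici (q * T)) := fun s hs t ht hst => by
    have h1 : t⁻¹ ≤ s⁻¹ := inv_anti₀ (hqT.trans_le hs) hst
    have h2 : 1 - c * s⁻¹ ≤ 1 - c * t⁻¹ := by gcongr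
    exact mul_le_mul h2 (hNmono hs ht hst) (hK0.le.trans (hNpos s hs))
      (by linarith [hhalf t ht])
  have hhcont : ContinuousOn h (Ici (q * T)) := by
    refine ContinuousOn.mul ?_ ?_
    · exact continuousOn_const.sub (continuousOn_const.mul
        (continuousOn_id.inv₀ fun t ht => (hqT.trans_le ht).ne'))
    · exact continuousOn_const.add (continuousOn_const.mul
        (hcont.mono fun t ht => hqT1.trans ht))
  have hbarrier : ∀ t ≥ q * T, |z t| < t ^ κ * h t := fun t ht => by
    refine abs_lt_barrier (g := g) (G := fun t => J t - J (q * t)) hT hq0 hq1 hκq (fun s hs => ?_)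
      hz hhmono hhcont (fun s hs => (hTall s hs).1.2) (fun s hs => ?_) (fun s hs => ?_) ht
    · have h1 := (hTall s hs).1.1.2
      have hs0 : 0 < s⁻¹ := inv_pos.2 (hT.trans_le hs)
      have h2 : 0 < -b * c * s⁻¹ := by positivity
      rw [div_eq_mul_inv]
      linarith
    · have hs0 : 0 < s := hT.trans_le hs
      have hqs : q * T ≤ q * s := by gcongr
      have hqss : q * s ≤ s := by nlinarith
      have h1 := (hTall s hs).1.1.2
      have hd : 0 ≤ J s - J (q * s) :=
        sub_nonneg.2 (hmono (hqT1.trans hqs) (hqT1.trans (hqs.trans hqss)) hqss)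
      have hKq := hNpos (q * s) hqs
      have hsi : 0 < s⁻¹ := inv_pos.2 hs0
      -- The increment of `N` pays for the forcing; the multiple of `N (q s)` is the strict surplus.
      have e : -b * (h s - h (q * s)) + κ * h s / s =
          ((-b + (b * c + κ) * s⁻¹) + -κ * c * s⁻¹ * s⁻¹) * (N s - N (q * s)) +
            ((-b * c * (q⁻¹ - 1)) * s⁻¹ + κ * s⁻¹ + -κ * c * s⁻¹ * s⁻¹) * N (q * s) := by
        simp only [hh, mul_inv, div_eq_mul_inv]
        ring
      have e2 : N s - N (q * s) = m * (J s - J (q * s)) := by simp only [hN]; ring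
      rw [e, e2, hcb]
      have hκc : 0 ≤ -κ * c * s⁻¹ * s⁻¹ := by
        have : 0 < -κ := by linarith
        positivity
      have f1 : -b / 2 * (m * (J s - J (q * s))) ≤
          ((-b + (b * c + κ) * s⁻¹) + -κ * c * s⁻¹ * s⁻¹) * (m * (J s - J (q * s))) := by
        gcongr
        linarith
      have f2 : -b / 2 * (m * (J s - J (q * s))) = J s - J (q * s) := by
        have := hb.ne
        rw [hm]; field_simp
      have f3 : 0 < ((1 - κ) * s⁻¹ + κ * s⁻¹ + -κ * c * s⁻¹ * s⁻¹) * N (q * s) := by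
        refine mul_pos ?_ (hK0.trans_le hKq)
        have : (1 - κ) * s⁻¹ + κ * s⁻¹ = s⁻¹ := by ring
        linarith
      linarith
    · have hs0 : 0 < s := hqT.trans_le hs.1
      have hsκ := Real.rpow_pos_of_pos hs0 κ
      have h1 := (le_abs_self _).trans (hM s hs)
      rw [div_le_iff₀ hsκ] at h1
      have h2 : |M| + 1 ≤ h s := by
        calc |M| + 1 = 1 / 2 * K := by rw [hK]; ring
          _ ≤ h s := mul_le_mul (hhalf s hs.1) (hNpos s hs.1) hK0.le
            (by linarith [hhalf s hs.1])
      rw [mul_comm]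
      refine h1.trans_lt (mul_lt_mul_of_pos_right ?_ hsκ)
      linarith [le_abs_self M]
  refine ⟨max K m, lt_max_of_lt_left hK0, ?_⟩
  filter_upwards [eventually_ge_atTop (q * T)] with t ht
  have ht0 : 0 < t := hqT.trans_le ht
  have htκ := Real.rpow_pos_of_pos ht0 κ
  have hJt := hJ0 t (hqT1.trans ht)
  have h1 : h t ≤ max K m * (1 + J t) := by
    have h2 : 0 ≤ c * t⁻¹ := by positivity
    calc h t ≤ 1 * N t := by
          refine mul_le_mul_of_nonneg_right (by linarith) (hK0.le.trans (hNpos t ht))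
      _ ≤ max K m + max K m * J t := by
          rw [one_mul]
          exact add_le_add (le_max_left _ _) (mul_le_mul_of_nonneg_right (le_max_right _ _) hJt)
      _ = max K m * (1 + J t) := by ring
  calc |z t| ≤ t ^ κ * h t := (hbarrier t ht).le
    _ ≤ t ^ κ * (max K m * (1 + J t)) := by gcongr
    _ = max K m * (t ^ κ * (1 + J t)) := by ring

end Barrier

/-! ### Growth of solutions -/

lemma kappa_neg {a b q : ℝ} (hq0 : 0 < q) (hq1 : q < 1) (ha : a ≠ 0) (hab : |a| < |b|) :
    kappa a b q < 0 := by
  have h1 : 0 < Real.log |b / a| := by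
    refine Real.log_pos ?_
    rwa [abs_div, one_lt_div (abs_pos.2 ha)]
  have h2 : 0 < Real.log (1 / q) := Real.log_pos ((one_lt_div hq0).2 hq1)
  exact div_neg_of_neg_of_pos (neg_lt_zero.2 h1) h2

/-- With `κ < 0`, this balance is all that the growth estimates below need from the formula for `κ`.
-/
lemma abs_mul_rpow_kappa {a b q : ℝ} (hq0 : 0 < q) (hq1 : q < 1) (ha : a ≠ 0) (hb : b < 0) :
    |a| * q ^ kappa a b q = -b := by
  have hl : Real.log q ≠ 0 := (Real.log_neg hq0 hq1).ne
  have h : Real.log q * kappa a b q = Real.log |b / a| := by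
    rw [kappa, one_div, Real.log_inv]
    field_simp
  rw [Real.rpow_def_of_pos hq0, h, Real.exp_log (abs_pos.2 (div_ne_zero hb.ne ha)), abs_div,
    mul_div_cancel₀ _ (abs_pos.2 ha).ne', abs_of_neg hb]

variable {a b q ζ η κ : ℝ} {f x y γ : ℝ → ℝ}

lemma IsForcedSolution.hasDerivAt_sub (hx : IsForcedSolution a b q f ζ x)
    (hy : IsAuxiliarySolution f y) (t : ℝ) (ht : 0 < t) :
    HasDerivAt (fun t => x t - y t)
      (a * (x (q * t) - y (q * t)) + b * (x t - y t) + (a * y (q * t) + (1 + b) * y t)) t :=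
  (((hx.deriv t ht.le).hasDerivAt (Ici_mem_nhds ht)).sub
    ((hy.deriv t ht.le).hasDerivAt (Ici_mem_nhds ht))).congr_deriv (by ring)

lemma IsRegularlyVarying.integrand_pos (hγ : IsRegularlyVarying γ η) {s : ℝ} (hs : 0 < s) :
    0 < γ s / s ^ (κ + 1) := div_pos (hγ.pos s hs.le) (Real.rpow_pos_of_pos hs _)

/-- The increment over `[q t, t]` of a primitive of `γ s / s ^ (κ + 1)` dominates `γ t / t ^ κ`. -/
lemma IsRegularlyVarying.exists_le_increment (hγ : IsRegularlyVarying γ η) (hq0 : 0 < q)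
    (hq1 : q < 1) (hκ : κ < 0)
    (hint : ∀ t, IntegrableOn (fun s => γ s / s ^ (κ + 1)) (Ioc 1 t)) :
    ∃ E > 0, ∀ᶠ t in atTop, γ t ≤ E * (t ^ κ *
      ((∫ s in Ioc 1 t, γ s / s ^ (κ + 1)) - ∫ s in Ioc 1 (q * t), γ s / s ^ (κ + 1))) := by
  obtain ⟨C, hC, T, hT, h⟩ := hγ.exists_bound_Icc hq0 hq1
  have hqκ : 0 < q ^ κ := Real.rpow_pos_of_pos hq0 κ
  have hq1' : 0 < 1 - q := by linarith
  refine ⟨C * q ^ κ / (1 - q), by positivity, ?_⟩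
  filter_upwards [eventually_ge_atTop T, eventually_ge_atTop q⁻¹] with t htT htq
  have ht0 : 0 < t := hT.trans_le htT
  have hqt1 : 1 ≤ q * t := by rwa [← inv_mul_le_iff₀ hq0, mul_one]
  have hqt : q * t ≤ t := by nlinarith
  have hqt0 : 0 < q * t := by positivity
  have htκ : 0 < t ^ κ := Real.rpow_pos_of_pos ht0 κ
  have hγt := hγ.pos t ht0.le
  have hsub : Ioc (q * t) t ⊆ Ioc 1 t := Ioc_subset_Ioc_left hqt1
  have hunion : (∫ s in Ioc 1 t, γ s / s ^ (κ + 1)) =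
      (∫ s in Ioc 1 (q * t), γ s / s ^ (κ + 1)) + ∫ s in Ioc (q * t) t, γ s / s ^ (κ + 1) := by
    rw [← Ioc_union_Ioc_eq_Ioc hqt1 hqt, setIntegral_union
      (Ioc_disjoint_Ioc_of_le le_rfl) measurableSet_Ioc (hint _) ((hint t).mono_set hsub)]
  rw [hunion, add_sub_cancel_left]
  -- A lower bound for the integrand on `[q t, t]`, using `γ t ≤ C γ s`, `s ≤ t` and, as `κ < 0`, `s
  -- ^ κ ≤ (q t) ^ κ`.
  set L := γ t / (C * q ^ κ * t ^ κ * t) with hL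
  have hlow : L * ((1 - q) * t) ≤ ∫ s in Ioc (q * t) t, γ s / s ^ (κ + 1) := by
    have h1 := setIntegral_ge_of_const_le_real (c := L) (μ := volume) (s := Ioc (q * t) t)
      (f := fun s => γ s / s ^ (κ + 1)) measurableSet_Ioc (by simp) (fun s hs => ?_)
      ((hint t).mono_set hsub)
    · rwa [Measure.real, Real.volume_Ioc, ENNReal.toReal_ofReal (by linarith),
        show t - q * t = (1 - q) * t by ring] at h1
    · have hs0 : 0 < s := hqt0.trans hs.1
      have h2 := (h t htT s ⟨hs.1.le, hs.2⟩).2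
      have h3 : s ^ κ ≤ q ^ κ * t ^ κ := by
        rw [← Real.mul_rpow hq0.le ht0.le]
        exact Real.rpow_le_rpow_of_nonpos hqt0 hs.1.le hκ.le
      have hsκ : 0 < s ^ κ := Real.rpow_pos_of_pos hs0 κ
      rw [Real.rpow_add_one hs0.ne', hL, div_le_div_iff₀ (by positivity) (by positivity)]
      calc γ t * (s ^ κ * s) ≤ (C * γ s) * ((q ^ κ * t ^ κ) * t) := by
            have := hγ.pos s hs0.le
            gcongr
            exact hs.2
        _ = γ s * (C * q ^ κ * t ^ κ * t) := by ring
  calc γ t = C * q ^ κ / (1 - q) * (t ^ κ * (L * ((1 - q) * t))) := by rw [hL]; field_simp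
    _ ≤ _ := by gcongr

lemma IsRegularlyVarying.monotone_primitive (hγ : IsRegularlyVarying γ η)
    (hint : ∀ t, IntegrableOn (fun s => γ s / s ^ (κ + 1)) (Ioc 1 t)) :
    Monotone fun t => ∫ s in Ioc 1 t, γ s / s ^ (κ + 1) := fun _ t hst => by
  refine setIntegral_mono_set (hint t) ?_ (Ioc_subset_Ioc_right hst).eventuallyLE
  refine (ae_restrict_iff' measurableSet_Ioc).2 (Eventually.of_forall fun s hs => ?_)
  exact (hγ.integrand_pos (by linarith [hs.1])).le

lemma continuousOn_primitive_Ici {u : ℝ → ℝ} (hint : ∀ t, IntegrableOn u (Ioc 1 t)) :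
    ContinuousOn (fun t => ∫ s in Ioc 1 t, u s) (Ici 1) := fun t ht => by
  have h := intervalIntegral.continuousOn_primitive (μ := volume) (f := u) (a := 1) (b := t + 1)
    ((integrableOn_Icc_iff_integrableOn_Ioc (by simp)).2 (hint _))
  refine (h t ⟨ht, by linarith⟩).mono_of_mem_nhdsWithin ?_
  exact mem_nhdsWithin.2 ⟨Iio (t + 1), isOpen_Iio, by simp, fun s hs => ⟨hs.2, hs.1.le⟩⟩

theorem exists_bound_solution (hq0 : 0 < q) (hq1 : q < 1) (hb : b < 0)
    (hκq : |a| * q ^ κ = -b) (hκ : κ < 0) (hx : IsForcedSolution a b q f ζ x)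
    (hy : IsAuxiliarySolution f y) (hγ : IsRegularlyVarying γ η) (hyγ : y =O[atTop] γ)
    (hint : ∀ t, IntegrableOn (fun s => γ s / s ^ (κ + 1)) (Ioc 1 t)) :
    ∃ K > 0, ∀ᶠ t in atTop, |x t| ≤ K * (t ^ κ * ∫ s in Ioc 1 t, γ s / s ^ (κ + 1)) := by
  set I : ℝ → ℝ := fun t => ∫ s in Ioc 1 t, γ s / s ^ (κ + 1) with hI
  have hImono : Monotone I := hγ.monotone_primitive hint
  have hI1 : I 1 = 0 := by simp [hI]
  have hI0 : ∀ t ≥ 1, 0 ≤ I t := fun t ht => hI1 ▸ hImono ht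
  have hIcont : ContinuousOn I (Ici 1) := continuousOn_primitive_Ici hint
  obtain ⟨E, hE, hinc⟩ := hγ.exists_le_increment hq0 hq1 hκ hint
  obtain ⟨D, hD, hDb⟩ := hyγ.exists_pos
  have hyq : (fun t => a * y (q * t) + (1 + b) * y t) =O[atTop] γ :=
    (((hyγ.comp_tendsto (tendsto_id.const_mul_atTop hq0)).trans
      (hγ.isBigO_comp_mul hq0)).const_mul_left a).add (hyγ.const_mul_left _)
  obtain ⟨G, hG, hGb⟩ := hyq.exists_pos
  have hz := exists_bound_of_increments (z := fun t => x t - y t) (J := fun t => G * E * I t)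
    (g := fun t => a * y (q * t) + (1 + b) * y t) hq0 hq1 hb hκq hκ
    (hx.hasDerivAt_sub hy) (fun t ht => mul_nonneg (by positivity) (hI0 t ht))
    ((hImono.const_mul (by positivity)).monotoneOn _) (continuousOn_const.mul hIcont) (by
      filter_upwards [hGb.bound, hinc, hγ.eventually_pos] with t h1 h2 h3
      rw [Real.norm_eq_abs, Real.norm_of_nonneg h3.le] at h1
      calc _ ≤ G * γ t := h1
        _ ≤ G * (E * (t ^ κ * (I t - I (q * t)))) := by gcongr
        _ = t ^ κ * (G * E * I t - G * E * I (q * t)) := by ring)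
  obtain ⟨K, hK, hzK⟩ := hz
  -- Positivity of `I T` lets the summand `1` in the barrier bound be absorbed into `(I T)⁻¹ * I t`.
  obtain ⟨T, hT1, hIT⟩ : ∃ T ≥ 1, 0 < I T := by
    obtain ⟨t, h1, h2, h3, h4⟩ := (hinc.and (hγ.eventually_pos.and
      ((eventually_ge_atTop 1).and (eventually_ge_atTop q⁻¹)))).exists
    refine ⟨t, h3, ?_⟩
    have h5 := h2.trans_le h1
    have ht0 : 0 < t := by linarith
    have htκ := Real.rpow_pos_of_pos ht0 κ
    rw [mul_pos_iff_of_pos_left hE, mul_pos_iff_of_pos_left htκ] at h5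
    have hqt1 : 1 ≤ q * t := by rwa [← inv_mul_le_iff₀ hq0, mul_one]
    linarith [hI0 _ hqt1]
  refine ⟨K * ((I T)⁻¹ + G * E) + D * E, by positivity, ?_⟩
  filter_upwards [hzK, hDb.bound, hinc, hγ.eventually_pos, eventually_ge_atTop T,
    eventually_ge_atTop q⁻¹] with t h1 h2 h3 h4 h5 h6
  rw [Real.norm_eq_abs, Real.norm_of_nonneg h4.le] at h2
  have ht0 : 0 < t := by linarith
  have htκ := Real.rpow_pos_of_pos ht0 κ
  have hqt1 : 1 ≤ q * t := by rwa [← inv_mul_le_iff₀ hq0, mul_one]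
  have hIt : I T ≤ I t := hImono h5
  have h7 : 1 ≤ (I T)⁻¹ * I t := by rwa [inv_mul_eq_div, one_le_div hIT]
  have h8 : I t - I (q * t) ≤ I t := by linarith [hI0 _ hqt1]
  calc |x t| = |(x t - y t) + y t| := by rw [sub_add_cancel]
    _ ≤ |x t - y t| + |y t| := abs_add_le _ _
    _ ≤ K * (t ^ κ * (1 + G * E * I t)) + D * γ t := add_le_add h1 h2
    _ ≤ K * (t ^ κ * ((I T)⁻¹ * I t + G * E * I t)) + D * (E * (t ^ κ * I t)) := by
      gcongr
      exact h3.trans (by gcongr)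
    _ = (K * ((I T)⁻¹ + G * E) + D * E) * (t ^ κ * I t) := by ring

theorem isBigO_rpow_of_integrableOn (hq0 : 0 < q) (hq1 : q < 1) (hb : b < 0)
    (hκq : |a| * q ^ κ = -b) (hκ : κ < 0) (hx : IsForcedSolution a b q f ζ x)
    (hy : IsAuxiliarySolution f y) (hγ : IsRegularlyVarying γ η) (hyγ : y =O[atTop] γ)
    (hint : IntegrableOn (fun s => γ s / s ^ (κ + 1)) (Ioi 1)) :
    x =O[atTop] fun t => t ^ κ := by
  obtain ⟨K, hK, h⟩ := exists_bound_solution hq0 hq1 hb hκq hκ hx hy hγ hyγ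
    fun t => hint.mono_set Ioc_subset_Ioi_self
  refine IsBigO.of_bound (K * ∫ s in Ioi 1, γ s / s ^ (κ + 1)) ?_
  filter_upwards [h, eventually_gt_atTop 0] with t ht ht0
  have htκ := Real.rpow_pos_of_pos ht0 κ
  have hle : ∫ s in Ioc 1 t, γ s / s ^ (κ + 1) ≤ ∫ s in Ioi 1, γ s / s ^ (κ + 1) := by
    refine setIntegral_mono_set hint ?_ Ioc_subset_Ioi_self.eventuallyLE
    refine (ae_restrict_iff' measurableSet_Ioi).2 (Eventually.of_forall fun s hs => ?_)
    exact (hγ.integrand_pos (by linarith [mem_Ioi.1 hs])).le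
  rw [Real.norm_eq_abs, Real.norm_of_nonneg htκ.le]
  calc |x t| ≤ K * (t ^ κ * ∫ s in Ioc 1 t, γ s / s ^ (κ + 1)) := ht
    _ ≤ K * (t ^ κ * ∫ s in Ioi 1, γ s / s ^ (κ + 1)) := by gcongr
    _ = K * (∫ s in Ioi 1, γ s / s ^ (κ + 1)) * t ^ κ := by ring

/-- The truncation at `1` secures positivity at `t = 0`, where `0 ^ ρ = 0` for `ρ ≠ 0`. -/
lemma isRegularlyVarying_max_rpow (ρ : ℝ) : IsRegularlyVarying (fun t => max t 1 ^ ρ) ρ where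
  measurable := by fun_prop
  pos t _ := by positivity
  tendsto l hl := by
    refine tendsto_const_nhds.congr' ?_
    filter_upwards [eventually_ge_atTop 1,
      (tendsto_id.const_mul_atTop hl).eventually_ge_atTop 1] with t h1 h2
    have ht : 0 < t := by linarith
    have htρ := Real.rpow_pos_of_pos ht ρ
    rw [max_eq_left h1, max_eq_left (show 1 ≤ l * t from h2), Real.mul_rpow hl.le ht.le,
      mul_div_cancel_right₀ _ htρ.ne']

/-- A power `t ^ ρ` with `η < ρ < κ` dominates `γ` and makes the weighted integral converge, whereas
`γ` itself need not be locally integrable. -/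
theorem isBigO_rpow_of_index_lt (hq0 : 0 < q) (hq1 : q < 1) (hb : b < 0)
    (hκq : |a| * q ^ κ = -b) (hκ : κ < 0) (hx : IsForcedSolution a b q f ζ x)
    (hy : IsAuxiliarySolution f y) (hγ : IsRegularlyVarying γ η) (hyγ : y =O[atTop] γ)
    (hη : η < κ) : x =O[atTop] fun t => t ^ κ := by
  obtain ⟨ρ, hρ1, hρ2⟩ := exists_between hη
  obtain ⟨K, hK, T, hT, h⟩ := hγ.isBigO_rpow hρ1
  have hγρ : γ =O[atTop] fun t => max t 1 ^ ρ := by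
    refine IsBigO.of_bound K ?_
    filter_upwards [eventually_ge_atTop T, eventually_ge_atTop 1, hγ.eventually_pos]
      with t h1 h2 h3
    rw [max_eq_left h2, Real.norm_of_nonneg h3.le, Real.norm_of_nonneg (by positivity)]
    exact h t h1
  refine isBigO_rpow_of_integrableOn hq0 hq1 hb hκq hκ hx hy (isRegularlyVarying_max_rpow ρ)
    (hyγ.trans hγρ) ?_
  refine (integrableOn_Ioi_rpow_of_lt (a := ρ - (κ + 1)) (by linarith) one_pos).congr_fun
    (fun s hs => ?_) measurableSet_Ioi
  have hs1 : 1 < s := hs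
  simp only []
  rw [max_eq_left hs1.le, Real.rpow_sub (by linarith)]

lemma IsRegularlyVarying.aemeasurable_integrand (hγ : IsRegularlyVarying γ η) (t : ℝ) :
    AEMeasurable (fun s => γ s / s ^ (κ + 1)) (volume.restrict (Ioc 1 t)) :=
  (hγ.measurable.mono_set fun _ hs => (zero_lt_one.trans hs.1).le).div (by fun_prop)

theorem exists_le_criticalBound (hq0 : 0 < q) (hq1 : q < 1) (hb : b < 0)
    (hκq : |a| * q ^ κ = -b) (hκ : κ < 0) (hx : IsForcedSolution a b q f ζ x)
    (hy : IsAuxiliarySolution f y) (hγ : IsRegularlyVarying γ η) (hyγ : y =O[atTop] γ) :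
    ∃ C : ℝ≥0, ∀ᶠ t in atTop, ENNReal.ofReal |x t| ≤ C * criticalBound κ γ t := by
  have hnn : ∀ t, 0 ≤ᵐ[volume.restrict (Ioc 1 t)] fun s => γ s / s ^ (κ + 1) := fun t =>
    (ae_restrict_iff' measurableSet_Ioc).2 (Eventually.of_forall fun s hs =>
      (hγ.integrand_pos (by linarith [hs.1])).le)
  by_cases hint : ∀ t, IntegrableOn (fun s => γ s / s ^ (κ + 1)) (Ioc 1 t)
  · obtain ⟨K, hK, h⟩ := exists_bound_solution hq0 hq1 hb hκq hκ hx hy hγ hyγ hint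
    refine ⟨K.toNNReal, ?_⟩
    filter_upwards [h, eventually_gt_atTop 0] with t ht ht0
    have htκ := Real.rpow_pos_of_pos ht0 κ
    rw [criticalBound, ← ofReal_integral_eq_lintegral_ofReal (hint t) (hnn t),
      ← ENNReal.ofReal_mul htκ.le]
    change _ ≤ ENNReal.ofReal K * _
    rw [← ENNReal.ofReal_mul hK.le]
    exact ENNReal.ofReal_le_ofReal ht
  -- If the integral over some bounded interval diverges, the bound is eventually `⊤` and nothing
  -- remains to prove.
  · push Not at hint
    obtain ⟨t₁, ht₁⟩ := hint
    have htop : ∫⁻ s in Ioc 1 t₁, ENNReal.ofReal (γ s / s ^ (κ + 1)) = ⊤ := by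
      by_contra hne
      exact ht₁ ((lintegral_ofReal_ne_top_iff_integrable
        (hγ.aemeasurable_integrand t₁).aestronglyMeasurable (hnn t₁)).1 hne)
    refine ⟨1, ?_⟩
    filter_upwards [eventually_ge_atTop t₁, eventually_gt_atTop 0] with t ht ht0
    have h1 : ∫⁻ s in Ioc 1 t, ENNReal.ofReal (γ s / s ^ (κ + 1)) = ⊤ :=
      top_le_iff.1 (htop.symm.le.trans (lintegral_mono_set (Ioc_subset_Ioc_right ht)))
    rw [criticalBound, h1, ENNReal.mul_top]
    · simp
    · simpa using Real.rpow_pos_of_pos ht0 κ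

end Pantograph

theorem mainTheorem7 (a b q ζ η : ℝ) (f x y γ : ℝ → ℝ)
    (hq0 : 0 < q) (hq1 : q < 1) (ha : a ≠ 0) (hb : b < 0) (hab : |a| < |b|)
    (hf : ContinuousOn f (Ici 0))
    (hx : Pantograph.IsForcedSolution a b q f ζ x)
    (hy : Pantograph.IsAuxiliarySolution f y)
    (hγ : Pantograph.IsRegularlyVarying γ η) :
    -- part (i)
    (y =O[atTop] γ →
      -- (A)
      (η < Pantograph.kappa a b q →
        x =O[atTop] fun t => t ^ Pantograph.kappa a b q) ∧
      -- (B)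
      (η = Pantograph.kappa a b q →
        IntegrableOn (fun t => γ t / t ^ (Pantograph.kappa a b q + 1)) (Ioi 1) →
          (x =O[atTop] fun t => t ^ Pantograph.kappa a b q) ∧
          (0 < Pantograph.limsupRatio y γ ∧ Pantograph.limsupRatio y γ < ⊤ →
            0 < Pantograph.limsupRatio x γ)) ∧
      -- (C)
      (η = Pantograph.kappa a b q →
        ¬ IntegrableOn (fun t => γ t / t ^ (Pantograph.kappa a b q + 1)) (Ioi 1) →
          (∃ C : ℝ≥0, ∀ᶠ t in atTop,
            ENNReal.ofReal |x t| ≤ C * Pantograph.criticalBound (Pantograph.kappa a b q) γ t) ∧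
          (0 < Pantograph.limsupRatio y γ → 0 < Pantograph.limsupRatio x γ))) ∧
    -- part (ii)
    (x =O[atTop] γ → y =O[atTop] γ) ∧
    (x =o[atTop] γ → y =o[atTop] γ) := by
  have hκ := Pantograph.kappa_neg hq0 hq1 ha hab
  have hκq := Pantograph.abs_mul_rpow_kappa hq0 hq1 ha hb
  refine ⟨fun hyγ => ⟨fun hη => ?_, fun _ hint => ⟨?_, fun h => ?_⟩, fun _ _ => ⟨?_, fun h => ?_⟩⟩,
    Pantograph.isBigO_auxiliary_of_isBigO hq0 hx hy hγ,
    Pantograph.isLittleO_auxiliary_of_isLittleO hq0 hx hy hγ⟩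
  · exact Pantograph.isBigO_rpow_of_index_lt hq0 hq1 hb hκq hκ hx hy hγ hyγ hη
  · exact Pantograph.isBigO_rpow_of_integrableOn hq0 hq1 hb hκq hκ hx hy hγ hyγ hint
  · exact Pantograph.limsupRatio_pos_of_auxiliary hq0 hx hy hγ h.1
  · exact Pantograph.exists_le_criticalBound hq0 hq1 hb hκq hκ hx hy hγ hyγ
  · exact Pantograph.limsupRatio_pos_of_auxiliary hq0 hx hy hγ h
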